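/- Random pentagon chains. For $n\ge 1$ let $PG_n$ be the graph made of $n$ pentagons $O_1,\dots,O_n$, where the vertices of each pentagon are labelled cyclically $x_1,\dots,x_5$, and for $1\le k<n$ the vertex $x_1$ of $O_{k+1}$ is joined by an edge to a vertex $u_k$ of $O_k$. The vertex $u_1$ is arbitrary. For $k\ge 2$ the step from $PG_k$ to $PG_{k+1}$ is random: it is of kind 1 if $u_k\in\{x_2,x_5\}$ and of kind 2 if $u_k\in\{x_3,x_4\}$; $Z^i_k$ $(i=1,2)$ is the $\{0,1\}$-valued indicator that it is of kind $i$, so that $Z^1_k+Z^2_k=1$. Hypothesis 1: the pairs $(Z^1_k,Z^2_k)$, $k\ge2$, are independent, and $\mathbb P(Z^i_k=1)=p_i$, $\mathbb P(Z^i_k=0)=1-p_i$ for $i=1,2$, with constants $p_1$ and $p_2=1-p_1$. Hypothesis 2: $0<p_1<1$ (hence $0<p_2<1$). For a finite connected graph $G$ with vertex degrees $d(v)$ let $r(u,v)$ be the resistance distance (the effective resistance between $u$ and $v$ when every edge is a unit resistor), and let $$Kf^*(G)=\sum_{\{u,v\}\subseteq V_G}d(u)d(v)\,r(u,v)$$ be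 the multiplicative degree-Kirchhoff index. Put $\hat U_k=\frac{1296}{5}Z^1_k+\frac{1584}{5}Z^2_k$ and $\hat V_k=\frac{876}{5}Z^1_k+\frac{1164}{5}Z^2_k$ for $k\ge2$, and $$\sigma_3^2=\left(\tfrac{1296}{5}\right)^2p_1+\left(\tfrac{1584}{5}\right)^2(1-p_1)-\left(\tfrac{1296}{5}p_1+\tfrac{1584}{5}(1-p_1)\right)^2,$$ $$\tilde\sigma_3^2=\left(\tfrac{876}{5}\right)^2p_1+\left(\tfrac{1164}{5}\right)^2(1-p_1)-\left(\tfrac{876}{5}p_1+\tfrac{1164}{5}(1-p_1)\right)^2,$$ $$r_3=\tfrac{1296}{5}\cdot\tfrac{876}{5}\,p_1+\tfrac{1584}{5}\cdot\tfrac{1164}{5}(1-p_1)-\left(\tfrac{1296}{5}p_1+\tfrac{1584}{5}(1-p_1)\right)\left(\tfrac{876}{5}p_1+\tfrac{1164}{5}(1-p_1)\right).$$ **Theorem 3.3.** Under Hypotheses 1 and 2, $\operatorname{Var}(\hat U_k)=\sigma_3^2$, $\operatorname{Var}(\hat V_k)=\tilde\sigma_3^2$ and $\operatorname{Cov}(\hat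 U_k,\hat V_k)=r_3$ for all $k\ge2$, and the following hold. (i) For every $n\ge1$, $Kf^*(PG_n)$ is square-integrable and $$\operatorname{Var}\big(Kf^*(PG_n)\big)=\tfrac1{30}\Big(\sigma_3^2n^5-5r_3n^4+10\tilde\sigma_3^2n^3+(65r_3-30\sigma_3^2-45\tilde\sigma_3^2)n^2+(59\sigma_3^2+65\tilde\sigma_3^2-120r_3)n+(60r_3-30\sigma_3^2-30\tilde\sigma_3^2)\Big).$$ (ii) $Kf^*(PG_n)$ is asymptotically normal, uniformly in $a$: $$\lim_{n\to\infty}\ \sup_{a\in\mathbb R}\left|\,\mathbb P\!\left(\frac{Kf^*(PG_n)-\mathbb E\big(Kf^*(PG_n)\big)}{\sqrt{\operatorname{Var}\big(Kf^*(PG_n)\big)}}\le a\right)-\int_{-\infty}^a\frac1{\sqrt{2\pi}}e^{-t^2/2}\,dt\,\right|=0.$$ -/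

import Mathlib

open MeasureTheory ProbabilityTheory Filter Topology

/-- `φ` is an electrical potential for a unit current entering the network `G` (every edge being a
unit resistor) at `u` and leaving it at `v`: Kirchhoff's current law together with Ohm's law says
`∑_{x ~ w} (φ w - φ x) = [w = u] - [w = v]` at every vertex `w`, i.e. `L φ = e_u - e_v` for the
Laplacian matrix `L` of `G`. -/
def IsUnitCurrentPotential {V : Type*} [Fintype V] [DecidableEq V]
    (G : SimpleGraph V) [DecidableRel G.Adj] (u v : V) (φ : V → ℝ) : Prop :=
  Matrix.mulVec (G.lapMatrix ℝ) φ = Pi.single u 1 - Pi.single v 1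

/-- The potential difference between `u` and `v` does not depend on the potential chosen. -/
theorem IsUnitCurrentPotential.sub_eq_sub {V : Type*} [Fintype V] [DecidableEq V]
    {G : SimpleGraph V} [DecidableRel G.Adj] {u v : V} {φ ψ : V → ℝ}
    (hφ : IsUnitCurrentPotential G u v φ) (hψ : IsUnitCurrentPotential G u v ψ) :
    φ u - φ v = ψ u - ψ v := by
  classical
  have hr : G.Reachable u v := by
    by_contra hn
    set x : V → ℝ := fun w => if G.Reachable u w then 1 else 0 with hx
    have hx0 : Matrix.mulVec (G.lapMatrix ℝ) x = 0 := by
      rw [SimpleGraph.lapMatrix_mulVec_eq_zero_iff_forall_reachable]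
      intro i j hij
      have : G.Reachable u i ↔ G.Reachable u j :=
        ⟨fun h => h.trans hij, fun h => h.trans hij.symm⟩
      simp [hx, this]
    have hsymm : x ⬝ᵥ (Matrix.mulVec (G.lapMatrix ℝ) φ) = 0 := by
      rw [Matrix.dotProduct_mulVec, ← Matrix.mulVec_transpose,
        (G.isSymm_lapMatrix (R := ℝ)).eq, hx0, zero_dotProduct]
    rw [hφ] at hsymm
    simp [hx, dotProduct_sub, hn] at hsymm
  have h0 : Matrix.mulVec (G.lapMatrix ℝ) (φ - ψ) = 0 := by
    rw [Matrix.mulVec_sub, hφ, hψ, sub_self]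
  have := (SimpleGraph.lapMatrix_mulVec_eq_zero_iff_forall_reachable G).1 h0 u v hr
  simp only [Pi.sub_apply] at this
  linarith

open Classical in
/-- The resistance distance `r(u, v)` (effective resistance between `u` and `v` when every edge is
a unit resistor): the potential difference between `u` and `v` that a unit current from `u` to `v`
produces. (Such a potential exists if and only if `u` and `v` lie in the same component; in the
other case, which does not occur in a connected graph, the value is set to `0`.) -/
noncomputable def resistanceDist {V : Type*} [Fintype V] [DecidableEq V]
    (G : SimpleGraph V) [DecidableRel G.Adj] (u v : V) : ℝ :=
  if h : ∃ φ : V → ℝ, IsUnitCurrentPotential G u v φ then h.choose u - h.choose v else 0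

theorem resistanceDist_eq {V : Type*} [Fintype V] [DecidableEq V]
    {G : SimpleGraph V} [DecidableRel G.Adj] {u v : V} {φ : V → ℝ}
    (hφ : IsUnitCurrentPotential G u v φ) : resistanceDist G u v = φ u - φ v := by
  have h : ∃ φ : V → ℝ, IsUnitCurrentPotential G u v φ := ⟨φ, hφ⟩
  rw [resistanceDist, dif_pos h]
  exact h.choose_spec.sub_eq_sub hφ

/-- The multiplicative degree-Kirchhoff index
`Kf*(G) = ∑_{ {u,v} ⊆ V } d(u) d(v) r(u,v) = (1/2) ∑_u ∑_v d(u) d(v) r(u,v)`. -/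
noncomputable def mulDegreeKirchhoffIndex {V : Type*} [Fintype V] [DecidableEq V]
    (G : SimpleGraph V) [DecidableRel G.Adj] : ℝ :=
  (1 / 2) * ∑ u : V, ∑ v : V, (G.degree u : ℝ) * (G.degree v : ℝ) * resistanceDist G u v

/-- The chain of `n` pentagons `O_1, …, O_n` with attaching sites `s 1, …, s (n - 1)`.
The vertex `(i, a)` is the vertex `x_{a+1}` of the pentagon `O_{i+1}`, whose vertices
`x_1, …, x_5` are labelled cyclically, and for `1 ≤ k < n` the vertex `x_1` of `O_{k+1}` is
joined by an edge to the vertex `u_k = x_{s k + 1}` of `O_k`. -/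
def pentagonChain (n : ℕ) (s : ℕ → Fin 5) : SimpleGraph (Fin n × Fin 5) where
  Adj x y :=
    (x.1 = y.1 ∧ (y.2 = x.2 + 1 ∨ x.2 = y.2 + 1)) ∨
    ((y.1 : ℕ) = x.1 + 1 ∧ x.2 = s (x.1 + 1) ∧ y.2 = 0) ∨
    ((x.1 : ℕ) = y.1 + 1 ∧ y.2 = s (y.1 + 1) ∧ x.2 = 0)
  symm := ⟨by
    intro x y h
    rcases h with ⟨h, h'⟩ | h | h
    · exact Or.inl ⟨h.symm, h'.symm⟩
    · exact Or.inr (Or.inr h)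
    · exact Or.inr (Or.inl h)⟩
  loopless := ⟨by
    rintro ⟨i, a⟩ h
    rcases h with ⟨-, h⟩ | ⟨h, -⟩ | ⟨h, -⟩
    · simp only [or_self] at h
      revert h
      clear i
      revert a
      decide
    · simp at h
    · simp at h⟩

instance (n : ℕ) (s : ℕ → Fin 5) : DecidableRel (pentagonChain n s).Adj := fun x y =>
  inferInstanceAs (Decidable
    ((x.1 = y.1 ∧ (y.2 = x.2 + 1 ∨ x.2 = y.2 + 1)) ∨
    ((y.1 : ℕ) = x.1 + 1 ∧ x.2 = s (x.1 + 1) ∧ y.2 = 0) ∨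
    ((x.1 : ℕ) = y.1 + 1 ∧ y.2 = s (y.1 + 1) ∧ x.2 = 0)))

/-! All randomness enters through one weighted sum of independent indicators. The edges between
pentagons are bridges, so resistances add along the chain; `resistanceDist_pentagonChain` verifies
the resulting formula against Kirchhoff's equations. Appending a pentagon gives recursions for the
index and for the degree-weighted transmission of the attaching vertex (`chainIndex_succ`,
`chainTransmission_succ`). Solving them (`exists_chainIndex_eq`) shows that, with `m = n - 1`, the
index is a constant plus `144 ∑ j (m - j) r(x₁, u_{j+1})` over `1 ≤ j < m`; the vertex `u₁` does not
occur.

Almost surely `r(x₁, u_k) = 4/5 + 2/5 Z²_k`, so the random part is `288/5 ∑ j (m - j) Z²_{j+1}`.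
Independence and `∑ j² (m - j)² = (m⁵ - m)/30` give the variance. The two variances and the
covariance in the statement all equal `(288/5)² p₁ p₂`, so the polynomial there is this number times
`((n-1)⁵ - (n-1))/30`.

For normality, the normalized weights are `O(m^{-1/2})`, so the characteristic functions can be
compared factor by factor with Gaussian ones (`tendsto_charFun_weighted_sum`). Lévy's continuity
theorem and Pólya's theorem then yield uniform convergence of the distribution functions. -/

/-! ### Resistance distances in a pentagon chain. -/

/-- If `R` is symmetric with zero diagonal and each column of the Laplacian applied to `R` is
`-2 e_v` up to a vector independent of `v`, then `R` is the resistance distance. -/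
theorem resistanceDist_eq_of_laplacian {V : Type*} [Fintype V] [DecidableEq V]
    (G : SimpleGraph V) [DecidableRel G.Adj] (R : V → V → ℝ) (τ : V → ℝ)
    (hsymm : ∀ u v, R u v = R v u) (hdiag : ∀ u, R u u = 0)
    (hlap : ∀ w v, ∑ x ∈ G.neighborFinset w, (R w v - R x v) = τ w - if w = v then 2 else 0)
    (u v : V) : resistanceDist G u v = R u v := by
  -- Subtracting the columns of `v` and `u` cancels `τ`; halving turns the `2`s into unit currents.
  have hpot : IsUnitCurrentPotential G u v (fun w => (R w v - R w u) / 2) := by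
    funext w
    have h1 := hlap w v
    have h2 := hlap w u
    rw [Finset.sum_sub_distrib, Finset.sum_const, nsmul_eq_mul,
      SimpleGraph.card_neighborFinset_eq_degree] at h1 h2
    rw [SimpleGraph.lapMatrix_mulVec_apply, ← Finset.sum_div, Finset.sum_sub_distrib]
    simp only [Pi.sub_apply, Pi.single_apply]
    have e : ∀ t : V, (if w = t then (2 : ℝ) else 0) = 2 * if w = t then 1 else 0 := by
      intro t; split_ifs <;> norm_num
    rw [e] at h1 h2
    linarith
  rw [resistanceDist_eq hpot, hdiag, hdiag, hsymm v u]
  ring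

/-- The resistance distance in a pentagon. -/
noncomputable def pentRes (a b : Fin 5) : ℝ :=
  if a = b then 0 else if a = b + 1 ∨ b = a + 1 then 4 / 5 else 6 / 5

theorem pentRes_comm (a b : Fin 5) : pentRes a b = pentRes b a := by
  simp only [pentRes, eq_comm (a := a) (b := b), or_comm]

theorem pentRes_self (a : Fin 5) : pentRes a a = 0 := by simp [pentRes]

theorem pentRes_laplacian (a b : Fin 5) :
    2 * pentRes a b - pentRes (a + 1) b - pentRes (a - 1) b = 2 / 5 - if a = b then 2 else 0 := by
  have h : (-1 : Fin 5) = 4 := rfl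
  simp only [pentRes]
  fin_cases a <;> fin_cases b <;> simp [h] <;> norm_num

theorem sum_pentRes_right (a : Fin 5) : ∑ b, pentRes a b = 4 := by
  simp only [Fin.sum_univ_five, pentRes]
  fin_cases a <;> simp <;> norm_num

/-- The resistance distance in the chain from `x₁` of the first pentagon to `x₁` of the
pentagon with index `i`. -/
noncomputable def chainPos (s : ℕ → Fin 5) : ℕ → ℝ
  | 0 => 0
  | i + 1 => chainPos s i + pentRes 0 (s (i + 1)) + 1

/-- The resistance distance in the chain from the vertex `p` to the vertex `q` of a later
pentagon. -/
noncomputable def chainForward (s : ℕ → Fin 5) (p q : ℕ × Fin 5) : ℝ :=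
  chainPos s q.1 + pentRes 0 q.2
    - (chainPos s p.1 + pentRes 0 (s (p.1 + 1)) - pentRes p.2 (s (p.1 + 1)))

/-- The resistance distance in a pentagon chain. -/
noncomputable def chainRes (s : ℕ → Fin 5) (p q : ℕ × Fin 5) : ℝ :=
  if p.1 = q.1 then pentRes p.2 q.2
  else if p.1 < q.1 then chainForward s p q else chainForward s q p

theorem chainRes_comm (s : ℕ → Fin 5) (p q : ℕ × Fin 5) : chainRes s p q = chainRes s q p := by
  unfold chainRes
  rcases lt_trichotomy p.1 q.1 with h | h | h
  · simp [h, h.ne, h.ne', h.not_gt]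
  · simp [h, pentRes_comm]
  · simp [h, h.ne, h.ne', h.not_gt]

theorem chainRes_self (s : ℕ → Fin 5) (p : ℕ × Fin 5) : chainRes s p p = 0 := by
  simp [chainRes, pentRes_self]

theorem chainRes_of_lt {s : ℕ → Fin 5} {p q : ℕ × Fin 5} (h : p.1 < q.1) :
    chainRes s p q = chainForward s p q := by
  simp [chainRes, h, h.ne]

theorem chainRes_of_gt {s : ℕ → Fin 5} {p q : ℕ × Fin 5} (h : q.1 < p.1) :
    chainRes s p q = chainForward s q p := by
  rw [chainRes_comm, chainRes_of_lt h]

theorem chainRes_same (s : ℕ → Fin 5) (i : ℕ) (a b : Fin 5) :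
    chainRes s (i, a) (i, b) = pentRes a b := by
  simp [chainRes]

/-- A sum over the neighbours of a vertex of a pentagon chain. -/
theorem sum_neighborFinset_pentagonChain {n : ℕ} (s : ℕ → Fin 5) (w : Fin n × Fin 5)
    (f : ℕ × Fin 5 → ℝ) :
    ∑ x ∈ (pentagonChain n s).neighborFinset w, f (x.1, x.2) =
      f (w.1, w.2 + 1) + f (w.1, w.2 - 1)
        + (if (w.1 : ℕ) + 1 < n ∧ w.2 = s (w.1 + 1) then f (w.1 + 1, 0) else 0)
        + (if 0 < (w.1 : ℕ) ∧ w.2 = 0 then f (w.1 - 1, s w.1) else 0) := by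
  obtain ⟨i, a⟩ := w
  have hsum : ∑ x ∈ (pentagonChain n s).neighborFinset (i, a), f (x.1, x.2) =
      ∑ j ∈ Finset.range n, ∑ b,
        ((if (i : ℕ) = j then (if b = a + 1 ∨ a = b + 1 then f (i, b) else 0) else 0)
          + (if j = i + 1 then (if a = s (i + 1) ∧ b = 0 then f (i + 1, b) else 0) else 0)
          + (if (i : ℕ) = j + 1 then (if b = s (j + 1) ∧ a = 0 then f (j, b) else 0) else 0)) := by
    rw [← Fin.sum_univ_eq_sum_range (fun j => ∑ b,
        ((if (i : ℕ) = j then (if b = a + 1 ∨ a = b + 1 then f (i, b) else 0) else 0)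
          + (if j = i + 1 then (if a = s (i + 1) ∧ b = 0 then f (i + 1, b) else 0) else 0)
          + (if (i : ℕ) = j + 1 then (if b = s (j + 1) ∧ a = 0 then f (j, b) else 0) else 0))),
      ← Fintype.sum_prod_type', SimpleGraph.neighborFinset_eq_filter, Finset.sum_filter]
    refine Finset.sum_congr rfl ?_
    rintro ⟨j, b⟩ -
    simp only [pentagonChain, Fin.ext_iff (a := i)]
    rcases lt_trichotomy (i : ℕ) j with h | h | h
    · rw [if_neg h.ne, if_neg (by omega : ¬ (i : ℕ) = j + 1)]
      by_cases h' : (j : ℕ) = i + 1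
      · simp [h']
        refine if_congr ⟨?_, fun h => by simp [h]⟩ rfl rfl
        rintro (h1 | h1)
        · exact h1
        · omega
      · simp [h', h.ne]
        intro h1
        omega
    · simp [h]
    · rw [if_neg h.ne', if_neg (by omega : ¬ (j : ℕ) = i + 1)]
      by_cases h' : (i : ℕ) = j + 1
      · simp [h']
        refine if_congr ⟨?_, fun h => by simp [h]⟩ rfl rfl
        rintro (h1 | h1)
        · omega
        · exact h1
      · simp [h', h.ne']
        intro h1
        omega
  rw [hsum]
  simp only [Finset.sum_add_distrib]
  congr 1
  · congr 1
    · rw [Finset.sum_comm]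
      simp only [Finset.sum_ite_eq, Finset.mem_range, i.isLt, if_true]
      rw [Fin.sum_univ_five]
      fin_cases a <;> simp <;> first | rfl | exact add_comm _ _
    · rw [Finset.sum_comm]
      simp only [Finset.sum_ite_eq', Finset.mem_range]
      by_cases h : (i : ℕ) + 1 < n <;> by_cases h' : a = s (i + 1) <;> simp [h, h']
  · rcases hi : (i : ℕ) with _ | k
    · simp
    · have hk : k < n := by have := i.isLt; omega
      rw [Finset.sum_comm]
      simp only [Nat.add_right_cancel_iff, Finset.sum_ite_eq, Finset.mem_range, hk, if_true]
      by_cases h' : a = 0 <;> simp [h']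

/-- The degree of the vertex `p` in the chain of `n` pentagons. -/
noncomputable def chainDegree (n : ℕ) (s : ℕ → Fin 5) (p : ℕ × Fin 5) : ℝ :=
  2 + (if p.1 + 1 < n ∧ p.2 = s (p.1 + 1) then 1 else 0) + (if 0 < p.1 ∧ p.2 = 0 then 1 else 0)

theorem degree_pentagonChain {n : ℕ} (s : ℕ → Fin 5) (w : Fin n × Fin 5) :
    ((pentagonChain n s).degree w : ℝ) = chainDegree n s (w.1, w.2) := by
  have h := sum_neighborFinset_pentagonChain s w (fun _ => 1)
  rw [Finset.sum_const, SimpleGraph.card_neighborFinset_eq_degree, nsmul_one] at h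
  rw [h, chainDegree]
  norm_num

/-- A bridge at `w` contributes `+1` to the Laplacian if it leads towards `v` and `-1` otherwise.
Seen from another pentagon, `v` acts as the exit vertex towards it, where the pentagon term `-2`
turns this `+1` into `-1`. Hence away from `v` the total is `2/5` minus the number of bridges, that
is `12/5 - d(w)`. -/
theorem resistanceDist_pentagonChain {n : ℕ} (s : ℕ → Fin 5) (u v : Fin n × Fin 5) :
    resistanceDist (pentagonChain n s) u v = chainRes s (u.1, u.2) (v.1, v.2) := by
  refine resistanceDist_eq_of_laplacian (pentagonChain n s)
    (fun u v => chainRes s (u.1, u.2) (v.1, v.2))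
    (fun w => 12 / 5 - chainDegree n s (w.1, w.2))
    (fun _ _ => chainRes_comm _ _ _) (fun _ => chainRes_self _ _) ?_ u v
  rintro ⟨i, a⟩ ⟨j, b⟩
  rw [sum_neighborFinset_pentagonChain s (i, a)
    (fun x => chainRes s (i, a) (j, b) - chainRes s x (j, b))]
  have hin := i.isLt
  have hjn := j.isLt
  simp only [chainDegree, Prod.mk.injEq, Fin.ext_iff (a := i)]
  rcases lt_trichotomy (i : ℕ) j with h | h | h
  · have hi : (i : ℕ) + 1 < n := by omega
    -- For a later target the exit vertex is the attaching vertex.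
    have hlap := pentRes_laplacian a (s (i + 1))
    have hR : (if (i : ℕ) + 1 < n ∧ a = s (i + 1) then
          chainRes s (i, a) (j, b) - chainRes s ((i : ℕ) + 1, 0) (j, b) else 0) =
        if a = s (i + 1) then 1 else 0 := by
      simp only [hi, true_and]
      split_ifs with ha
      · rw [chainRes_of_lt (show ((i : ℕ), a).1 < ((j : ℕ), b).1 from h)]
        rcases (show (i : ℕ) + 1 = j ∨ (i : ℕ) + 1 < j by omega) with h' | h'
        · rw [h', chainRes_same, chainForward]
          simp only [← h', chainPos, ha, pentRes_self]
          ring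
        · rw [chainRes_of_lt (show ((i : ℕ) + 1, (0 : Fin 5)).1 < ((j : ℕ), b).1 from h')]
          simp only [chainForward, chainPos, ha, pentRes_self]
          ring
      · rfl
    have hL : (if 0 < (i : ℕ) ∧ a = 0 then
          chainRes s (i, a) (j, b) - chainRes s ((i : ℕ) - 1, s i) (j, b) else 0) =
        -(if 0 < (i : ℕ) ∧ a = 0 then 1 else 0) := by
      split_ifs with ha
      · obtain ⟨k, hk⟩ := Nat.exists_eq_add_one.2 ha.1
        rw [chainRes_of_lt (show ((i : ℕ), a).1 < ((j : ℕ), b).1 from h),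
          chainRes_of_lt (show ((i : ℕ) - 1, s i).1 < ((j : ℕ), b).1 by simp only; omega)]
        simp only [hk, add_tsub_cancel_right, chainForward, chainPos, ha.2, pentRes_self]
        ring
      · simp
    rw [hR, hL]
    simp only [h.ne, false_and, if_false, hi, true_and]
    rw [chainRes_of_lt (show ((i : ℕ), a).1 < ((j : ℕ), b).1 from h),
      chainRes_of_lt (show ((i : ℕ), a + 1).1 < ((j : ℕ), b).1 from h),
      chainRes_of_lt (show ((i : ℕ), a - 1).1 < ((j : ℕ), b).1 from h)]
    simp only [chainForward]
    have e : (if a = s (i + 1) then (2 : ℝ) else 0) = 2 * if a = s (i + 1) then 1 else 0 := by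
      split_ifs <;> norm_num
    rw [e] at hlap
    linarith
  · have hlap := pentRes_laplacian a b
    have hR : (if (i : ℕ) + 1 < n ∧ a = s (i + 1) then
          chainRes s (i, a) (j, b) - chainRes s ((i : ℕ) + 1, 0) (j, b) else 0) =
        -(if (i : ℕ) + 1 < n ∧ a = s (i + 1) then 1 else 0) := by
      split_ifs with ha
      · rw [h, chainRes_same,
          chainRes_of_gt (show ((j : ℕ), b).1 < ((j : ℕ) + 1, (0 : Fin 5)).1 from Nat.lt_succ_self _),
          ha.2, h, pentRes_comm]
        simp only [chainForward, chainPos, pentRes_self]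
        ring
      · simp
    have hL : (if 0 < (i : ℕ) ∧ a = 0 then
          chainRes s (i, a) (j, b) - chainRes s ((i : ℕ) - 1, s i) (j, b) else 0) =
        -(if 0 < (i : ℕ) ∧ a = 0 then 1 else 0) := by
      split_ifs with ha
      · obtain ⟨k, hk⟩ := Nat.exists_eq_add_one.2 ha.1
        rw [chainRes_of_lt (show ((i : ℕ) - 1, s i).1 < ((j : ℕ), b).1 by simp only; omega),
          ← h, chainRes_same]
        simp only [hk, add_tsub_cancel_right, chainForward, chainPos, ha.2, pentRes_self]
        ring
      · simp
    rw [hR, hL]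
    simp only [h, true_and, chainRes_same]
    linarith
  -- For an earlier target the exit vertex is `x₁`.
  · have hlap := pentRes_laplacian a 0
    have hR : (if (i : ℕ) + 1 < n ∧ a = s (i + 1) then
          chainRes s (i, a) (j, b) - chainRes s ((i : ℕ) + 1, 0) (j, b) else 0) =
        -(if (i : ℕ) + 1 < n ∧ a = s (i + 1) then 1 else 0) := by
      split_ifs with ha
      · rw [chainRes_of_gt (show ((j : ℕ), b).1 < ((i : ℕ), a).1 from h),
          chainRes_of_gt (show ((j : ℕ), b).1 < ((i : ℕ) + 1, (0 : Fin 5)).1 by simp only; omega)]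
        simp only [chainForward, chainPos, pentRes_self, ha.2]
        ring
      · simp
    have hL : (if 0 < (i : ℕ) ∧ a = 0 then
          chainRes s (i, a) (j, b) - chainRes s ((i : ℕ) - 1, s i) (j, b) else 0) =
        if a = 0 then 1 else 0 := by
      have hi : 0 < (i : ℕ) := by omega
      simp only [hi, true_and]
      split_ifs with ha
      · obtain ⟨k, hk⟩ := Nat.exists_eq_add_one.2 hi
        rw [chainRes_of_gt (show ((j : ℕ), b).1 < ((i : ℕ), a).1 from h)]
        rcases (show k = j ∨ (j : ℕ) < k by omega) with h' | h'
        · simp only [hk, add_tsub_cancel_right, ← h', chainRes_same, chainForward, chainPos, ha,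
            pentRes_self, pentRes_comm (s (k + 1)) b]
          ring
        · simp only [hk, add_tsub_cancel_right]
          rw [chainRes_of_gt (show ((j : ℕ), b).1 < (k, s (k + 1)).1 from h')]
          simp only [chainForward, chainPos, ha, pentRes_self]
          ring
      · rfl
    have hi : 0 < (i : ℕ) := by omega
    rw [hR, hL]
    simp only [h.ne', false_and, if_false, hi, true_and]
    rw [chainRes_of_gt (show ((j : ℕ), b).1 < ((i : ℕ), a).1 from h),
      chainRes_of_gt (show ((j : ℕ), b).1 < ((i : ℕ), a + 1).1 from h),
      chainRes_of_gt (show ((j : ℕ), b).1 < ((i : ℕ), a - 1).1 from h)]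
    simp only [chainForward, pentRes_comm 0]
    have e : (if a = 0 then (2 : ℝ) else 0) = 2 * if a = 0 then 1 else 0 := by
      split_ifs <;> norm_num
    rw [e] at hlap
    linarith

/-! ### Recursions for the index when a pentagon is appended. -/

/-- The vertices of the chain of `n` pentagons. -/
def chainVerts (n : ℕ) : Finset (ℕ × Fin 5) := Finset.range n ×ˢ Finset.univ

theorem mem_chainVerts {n : ℕ} {p : ℕ × Fin 5} : p ∈ chainVerts n ↔ p.1 < n := by
  simp [chainVerts]

theorem sum_chainVerts_succ (n : ℕ) (f : ℕ × Fin 5 → ℝ) :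
    ∑ p ∈ chainVerts (n + 1), f p = ∑ p ∈ chainVerts n, f p + ∑ b, f (n, b) := by
  simp only [chainVerts, Finset.sum_product, Finset.sum_range_succ]

theorem sum_fin_prod_eq_sum_chainVerts (n : ℕ) (f : ℕ × Fin 5 → ℝ) :
    ∑ p : Fin n × Fin 5, f (p.1, p.2) = ∑ p ∈ chainVerts n, f p := by
  rw [Fintype.sum_prod_type, chainVerts, Finset.sum_product]
  exact Fin.sum_univ_eq_sum_range (fun i => ∑ b, f (i, b)) n

theorem mulDegreeKirchhoffIndex_pentagonChain (n : ℕ) (s : ℕ → Fin 5) :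
    mulDegreeKirchhoffIndex (pentagonChain n s) =
      1 / 2 * ∑ p ∈ chainVerts n, ∑ q ∈ chainVerts n,
        chainDegree n s p * chainDegree n s q * chainRes s p q := by
  rw [mulDegreeKirchhoffIndex, ← sum_fin_prod_eq_sum_chainVerts]
  congr 1
  refine Finset.sum_congr rfl fun u _ => ?_
  rw [← sum_fin_prod_eq_sum_chainVerts]
  refine Finset.sum_congr rfl fun v _ => ?_
  rw [degree_pentagonChain, degree_pentagonChain, resistanceDist_pentagonChain]

theorem chainDegree_succ_old {n : ℕ} (s : ℕ → Fin 5) {p : ℕ × Fin 5} (hp : p ∈ chainVerts (n + 1)) :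
    chainDegree (n + 2) s p =
      chainDegree (n + 1) s p + if p = (n, s (n + 1)) then 1 else 0 := by
  obtain ⟨i, a⟩ := p
  rw [mem_chainVerts] at hp
  simp only at hp
  simp only [chainDegree, Prod.mk.injEq]
  rcases eq_or_ne i n with h | h
  · subst h
    simp
    ring
  · simp [h, (by omega : i < n), (by omega : i ≤ n)]

theorem chainDegree_succ_new (n : ℕ) (s : ℕ → Fin 5) (b : Fin 5) :
    chainDegree (n + 2) s (n + 1, b) = 2 + if b = 0 then 1 else 0 := by
  simp [chainDegree]

theorem chainRes_new {n : ℕ} (s : ℕ → Fin 5) {p : ℕ × Fin 5} (hp : p ∈ chainVerts (n + 1))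
    (b : Fin 5) :
    chainRes s p (n + 1, b) = chainRes s p (n, s (n + 1)) + 1 + pentRes 0 b := by
  obtain ⟨i, a⟩ := p
  rw [mem_chainVerts] at hp
  rw [chainRes_of_lt (show (i, a).1 < (n + 1, b).1 from hp)]
  rcases (show i < n ∨ i = n by simp only at hp; omega) with h | h
  · rw [chainRes_of_lt (show (i, a).1 < (n, s (n + 1)).1 from h)]
    simp only [chainForward, chainPos]
    ring
  · subst h
    rw [chainRes_same]
    simp only [chainForward, chainPos]
    ring

theorem sum_chainVerts_chainDegree (n : ℕ) (s : ℕ → Fin 5) :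
    ∑ p ∈ chainVerts (n + 1), chainDegree (n + 1) s p = 12 * n + 10 := by
  induction n with
  | zero =>
    rw [sum_chainVerts_succ]
    simp [chainVerts, chainDegree]
    norm_num
  | succ n ih =>
    rw [sum_chainVerts_succ, Finset.sum_congr rfl fun p hp => chainDegree_succ_old s hp,
      Finset.sum_add_distrib, ih, Finset.sum_congr rfl fun b _ => chainDegree_succ_new n s b,
      Finset.sum_ite_eq', if_pos (by simp [mem_chainVerts])]
    simp [Finset.sum_add_distrib]
    ring

/-- The degree-weighted sum of the resistance distances to the vertex of the last of `n + 1`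
pentagons to which the next pentagon gets attached. -/
noncomputable def chainTransmission (n : ℕ) (s : ℕ → Fin 5) : ℝ :=
  ∑ p ∈ chainVerts (n + 1), chainDegree (n + 1) s p * chainRes s p (n, s (n + 1))

/-- A single pentagon is vertex-transitive, so the value `2 * 4` does not depend on `s 1`. This is
why `u₁` may be arbitrary. -/
theorem chainTransmission_zero (s : ℕ → Fin 5) : chainTransmission 0 s = 8 := by
  rw [chainTransmission, sum_chainVerts_succ]
  simp only [chainVerts, Finset.range_zero, Finset.empty_product, Finset.sum_empty, zero_add,
    chainRes_same, pentRes_comm _ (s 1)]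
  simp [chainDegree, ← Finset.mul_sum, sum_pentRes_right]
  norm_num

theorem sum_chainDegree_mul_ite {n : ℕ} {p : ℕ × Fin 5} (hp : p ∈ chainVerts n)
    (f : ℕ × Fin 5 → ℝ) :
    ∑ q ∈ chainVerts n, (if q = p then 1 else 0) * f q = f p := by
  simp [hp]

theorem sum_new_chainDegree (n : ℕ) (s : ℕ → Fin 5) :
    ∑ b, chainDegree (n + 2) s (n + 1, b) = 11 := by
  simp [chainDegree_succ_new, Finset.sum_add_distrib]
  norm_num

theorem sum_new_chainDegree_mul_pentRes (n : ℕ) (s : ℕ → Fin 5) (a : Fin 5) :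
    ∑ b, chainDegree (n + 2) s (n + 1, b) * pentRes a b = 8 + pentRes 0 a := by
  simp [chainDegree_succ_new, add_mul, Finset.sum_add_distrib, ← Finset.mul_sum,
    sum_pentRes_right, pentRes_comm a 0]
  norm_num

theorem sum_succ_chainDegree (n : ℕ) (s : ℕ → Fin 5) :
    ∑ p ∈ chainVerts (n + 1), chainDegree (n + 2) s p = 12 * n + 11 := by
  have h := sum_chainVerts_chainDegree (n + 1) s
  rw [sum_chainVerts_succ, sum_new_chainDegree] at h
  push_cast at h
  linarith

/-- Attaching a pentagon changes only the degree of the attaching vertex, which is at distance `0`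
from itself. -/
theorem sum_succ_chainDegree_mul_chainRes (n : ℕ) (s : ℕ → Fin 5) :
    ∑ p ∈ chainVerts (n + 1), chainDegree (n + 2) s p * chainRes s p (n, s (n + 1)) =
      chainTransmission n s := by
  have hmem : (n, s (n + 1)) ∈ chainVerts (n + 1) := by simp [mem_chainVerts]
  rw [Finset.sum_congr rfl fun p hp => by rw [chainDegree_succ_old s hp, add_mul],
    Finset.sum_add_distrib, sum_chainDegree_mul_ite hmem, chainRes_self, add_zero,
    chainTransmission]

theorem sum_old_chainRes_new (n : ℕ) (s : ℕ → Fin 5) (b : Fin 5) :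
    ∑ p ∈ chainVerts (n + 1), chainDegree (n + 2) s p * chainRes s p (n + 1, b) =
      chainTransmission n s + (12 * n + 11) * (1 + pentRes 0 b) := by
  rw [← sum_succ_chainDegree_mul_chainRes, ← sum_succ_chainDegree, Finset.sum_mul,
    ← Finset.sum_add_distrib]
  refine Finset.sum_congr rfl fun p hp => ?_
  rw [chainRes_new s hp]
  ring

theorem chainTransmission_succ (n : ℕ) (s : ℕ → Fin 5) :
    chainTransmission (n + 1) s =
      chainTransmission n s + 12 * (n + 1) * pentRes 0 (s (n + 2)) + 12 * n + 19 := by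
  rw [chainTransmission, sum_chainVerts_succ, sum_old_chainRes_new]
  simp only [chainRes_same, pentRes_comm _ (s (n + 1 + 1)), sum_new_chainDegree_mul_pentRes]
  rw [pentRes_comm]
  ring

/-- The multiplicative degree-Kirchhoff index of the chain of `n + 1` pentagons. -/
noncomputable def chainIndex (n : ℕ) (s : ℕ → Fin 5) : ℝ :=
  mulDegreeKirchhoffIndex (pentagonChain (n + 1) s)

theorem chainIndex_zero (s : ℕ → Fin 5) : chainIndex 0 s = 40 := by
  rw [chainIndex, mulDegreeKirchhoffIndex_pentagonChain]
  simp only [sum_chainVerts_succ]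
  simp [chainVerts, chainDegree, chainRes_same, ← Finset.mul_sum, sum_pentRes_right]
  norm_num

/-- Old pairs gain one transmission from the raised degree at the attaching vertex. Cross pairs give
`11` transmissions plus `19 (12 n + 11)`, where `11` is the degree sum of the new pentagon and `19 =
11 + 8` adds the bridge and the distances from `x₁`. New pairs give `96 / 2`. -/
theorem chainIndex_succ (n : ℕ) (s : ℕ → Fin 5) :
    chainIndex (n + 1) s = chainIndex n s + 12 * chainTransmission n s + 228 * n + 257 := by
  have hmem : (n, s (n + 1)) ∈ chainVerts (n + 1) := by simp [mem_chainVerts]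
  set u : ℕ × Fin 5 := (n, s (n + 1)) with hu
  have hold : ∑ p ∈ chainVerts (n + 1), ∑ q ∈ chainVerts (n + 1),
      chainDegree (n + 2) s p * chainDegree (n + 2) s q * chainRes s p q =
      ∑ p ∈ chainVerts (n + 1), ∑ q ∈ chainVerts (n + 1),
        chainDegree (n + 1) s p * chainDegree (n + 1) s q * chainRes s p q
        + 2 * chainTransmission n s := by
    have h1 : ∀ p ∈ chainVerts (n + 1), ∑ q ∈ chainVerts (n + 1),
        chainDegree (n + 2) s p * chainDegree (n + 2) s q * chainRes s p q =
        ∑ q ∈ chainVerts (n + 1), chainDegree (n + 1) s p * chainDegree (n + 1) s q *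
          chainRes s p q
        + chainDegree (n + 1) s p * chainRes s p u
        + (if p = u then 1 else 0) *
          ∑ q ∈ chainVerts (n + 1), chainDegree (n + 2) s q * chainRes s p q := by
      intro p hp
      have h2 : chainDegree (n + 1) s p * chainRes s p u = ∑ q ∈ chainVerts (n + 1),
          (if q = u then 1 else 0) * (chainDegree (n + 1) s p * chainRes s p q) :=
        (sum_chainDegree_mul_ite hmem fun q => chainDegree (n + 1) s p * chainRes s p q).symm
      rw [h2, Finset.mul_sum, ← Finset.sum_add_distrib, ← Finset.sum_add_distrib]
      refine Finset.sum_congr rfl fun q hq => ?_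
      rw [chainDegree_succ_old s hp, chainDegree_succ_old s hq]
      ring
    rw [Finset.sum_congr rfl h1, Finset.sum_add_distrib, Finset.sum_add_distrib,
      sum_chainDegree_mul_ite hmem fun p =>
        ∑ q ∈ chainVerts (n + 1), chainDegree (n + 2) s q * chainRes s p q]
    simp only [chainRes_comm s u]
    rw [hu, sum_succ_chainDegree_mul_chainRes, chainTransmission]
    ring
  have hcross : ∑ p ∈ chainVerts (n + 1), ∑ b,
      chainDegree (n + 2) s p * chainDegree (n + 2) s (n + 1, b) * chainRes s p (n + 1, b) =
      11 * chainTransmission n s + (12 * n + 11) * 19 := by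
    rw [Finset.sum_comm]
    have h1 : ∀ b ∈ (Finset.univ : Finset (Fin 5)), ∑ p ∈ chainVerts (n + 1),
        chainDegree (n + 2) s p * chainDegree (n + 2) s (n + 1, b) * chainRes s p (n + 1, b) =
        chainDegree (n + 2) s (n + 1, b) * (chainTransmission n s + (12 * n + 11))
        + (12 * n + 11) * (chainDegree (n + 2) s (n + 1, b) * pentRes 0 b) := by
      intro b _
      have h2 := congrArg (chainDegree (n + 2) s (n + 1, b) * ·) (sum_old_chainRes_new n s b)
      simp only [Finset.mul_sum] at h2
      rw [Finset.sum_congr rfl fun p _ => by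
        rw [mul_comm (chainDegree (n + 2) s p), mul_assoc], h2]
      ring
    rw [Finset.sum_congr rfl h1, Finset.sum_add_distrib, ← Finset.sum_mul, ← Finset.mul_sum,
      sum_new_chainDegree, sum_new_chainDegree_mul_pentRes, pentRes_self]
    ring
  have hnew : ∑ a, ∑ b, chainDegree (n + 2) s (n + 1, a) * chainDegree (n + 2) s (n + 1, b) *
      chainRes s (n + 1, a) (n + 1, b) = 96 := by
    simp only [chainRes_same, mul_assoc, ← Finset.mul_sum, sum_new_chainDegree_mul_pentRes]
    simp only [mul_add, Finset.sum_add_distrib, ← Finset.sum_mul, sum_new_chainDegree,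
      sum_new_chainDegree_mul_pentRes, pentRes_self]
    norm_num
  have hcross' : ∑ a, ∑ p ∈ chainVerts (n + 1),
      chainDegree (n + 2) s (n + 1, a) * chainDegree (n + 2) s p * chainRes s (n + 1, a) p =
      11 * chainTransmission n s + (12 * n + 11) * 19 := by
    rw [← hcross, Finset.sum_comm]
    refine Finset.sum_congr rfl fun p _ => Finset.sum_congr rfl fun b _ => ?_
    rw [chainRes_comm]
    ring
  rw [chainIndex, chainIndex, mulDegreeKirchhoffIndex_pentagonChain,
    mulDegreeKirchhoffIndex_pentagonChain, sum_chainVerts_succ]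
  simp only [sum_chainVerts_succ (n + 1), Finset.sum_add_distrib]
  rw [hold, hcross, hcross', hnew]
  ring

theorem chainTransmission_eq (n : ℕ) (s : ℕ → Fin 5) :
    chainTransmission n s =
      ∑ j ∈ Finset.range n, (12 * (j + 1) * pentRes 0 (s (j + 2)) + 12 * j + 19) + 8 := by
  induction n with
  | zero => simp [chainTransmission_zero]
  | succ n ih => rw [chainTransmission_succ, ih, Finset.sum_range_succ]; ring

/-- The index of the chain is affine in the resistance distances `r(x₁, u_k)`. -/
theorem exists_chainIndex_eq (n : ℕ) : ∃ c : ℝ, ∀ s : ℕ → Fin 5,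
    chainIndex n s =
      c + 144 * ∑ j ∈ Finset.range (n - 1), (j + 1) * ((n : ℝ) - 1 - j) * pentRes 0 (s (j + 2)) := by
  -- The term `j = n - 1` has weight zero; keeping it makes the induction uniform. The site `s (j +
  -- 2)` enters the transmissions of stages `j + 1, …, n - 1`, whence the factor `n - 1 - j`.
  have h : ∃ c : ℝ, ∀ s : ℕ → Fin 5, chainIndex n s =
      c + 144 * ∑ j ∈ Finset.range n, (j + 1) * ((n : ℝ) - 1 - j) * pentRes 0 (s (j + 2)) := by
    induction n with
    | zero => exact ⟨40, fun s => by simp [chainIndex_zero]⟩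
    | succ n ih =>
      obtain ⟨c, hc⟩ := ih
      refine ⟨c + 12 * (∑ j ∈ Finset.range n, (12 * (j : ℝ) + 19) + 8) + 228 * n + 257,
        fun s => ?_⟩
      rw [chainIndex_succ, hc, chainTransmission_eq, Finset.sum_range_succ]
      have e1 : ∑ j ∈ Finset.range n, (12 * ((j : ℝ) + 1) * pentRes 0 (s (j + 2)) + 12 * j + 19) =
          12 * ∑ j ∈ Finset.range n, ((j : ℝ) + 1) * pentRes 0 (s (j + 2))
            + ∑ j ∈ Finset.range n, (12 * (j : ℝ) + 19) := by
        rw [Finset.mul_sum, ← Finset.sum_add_distrib]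
        exact Finset.sum_congr rfl fun j _ => by ring
      have e2 : ∑ j ∈ Finset.range n, ((j : ℝ) + 1) * (((n + 1 : ℕ) : ℝ) - 1 - j) *
            pentRes 0 (s (j + 2)) =
          ∑ j ∈ Finset.range n, ((j : ℝ) + 1) * ((n : ℝ) - 1 - j) * pentRes 0 (s (j + 2))
            + ∑ j ∈ Finset.range n, ((j : ℝ) + 1) * pentRes 0 (s (j + 2)) := by
        rw [← Finset.sum_add_distrib]
        exact Finset.sum_congr rfl fun j _ => by push_cast; ring
      rw [e1, e2]
      push_cast
      ring
  obtain ⟨c, hc⟩ := h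
  refine ⟨c, fun s => ?_⟩
  rw [hc]
  rcases n with _ | n
  · simp
  · rw [Finset.sum_range_succ]
    simp

/-! ### Central limit theorem for weighted sums. -/

/-- Factors are exchanged one at a time; the remaining ones have norm at most `1`. -/
theorem norm_prod_sub_prod_le {ι : Type*} (t : Finset ι) (a b : ι → ℂ)
    (ha : ∀ i ∈ t, ‖a i‖ ≤ 1) (hb : ∀ i ∈ t, ‖b i‖ ≤ 1) :
    ‖∏ i ∈ t, a i - ∏ i ∈ t, b i‖ ≤ ∑ i ∈ t, ‖a i - b i‖ := by
  classical
  induction t using Finset.induction_on with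
  | empty => simp
  | insert i t hi ih =>
    rw [Finset.prod_insert hi, Finset.prod_insert hi, Finset.sum_insert hi]
    have hbt : ‖∏ j ∈ t, b j‖ ≤ 1 := by
      rw [norm_prod]
      exact Finset.prod_le_one (fun _ _ => norm_nonneg _)
        fun j hj => hb j (Finset.mem_insert_of_mem hj)
    have hai := ha i (Finset.mem_insert_self i t)
    have ih' := ih (fun j hj => ha j (Finset.mem_insert_of_mem hj))
      (fun j hj => hb j (Finset.mem_insert_of_mem hj))
    calc ‖a i * ∏ j ∈ t, a j - b i * ∏ j ∈ t, b j‖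
        = ‖(a i - b i) * ∏ j ∈ t, b j + a i * (∏ j ∈ t, a j - ∏ j ∈ t, b j)‖ := by
          congr 1; ring
      _ ≤ ‖a i - b i‖ * ‖∏ j ∈ t, b j‖ + ‖a i‖ * ‖∏ j ∈ t, a j - ∏ j ∈ t, b j‖ := by
          refine (norm_add_le _ _).trans ?_
          rw [norm_mul, norm_mul]
      _ ≤ ‖a i - b i‖ * 1 + 1 * ∑ j ∈ t, ‖a j - b j‖ := by gcongr
      _ = _ := by ring

/-- The characteristic functions of normalized weighted sums of independent identically
distributed variables converge to that of the standard normal law when the weights are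
uniformly negligible. -/
theorem tendsto_charFun_weighted_sum {Ω : Type*} [MeasurableSpace Ω] {P : Measure Ω}
    [IsProbabilityMeasure P] {X : ℕ → Ω → ℝ} (hX : ∀ i, AEMeasurable (X i) P)
    (hindep : iIndepFun X P) (hident : ∀ i, P.map (X i) = P.map (X 0))
    (h0 : P[X 0] = 0) (h1 : P[X 0 ^ 2] = 1) {m : ℕ → ℕ} {w : ℕ → ℕ → ℝ}
    (hw : ∀ᶠ n in atTop, ∑ j ∈ Finset.range (m n), w n j ^ 2 = 1)
    (hw' : ∀ ε > 0, ∀ᶠ n in atTop, ∀ j < m n, |w n j| < ε) (t : ℝ) :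
    Tendsto (fun n => charFun (P.map fun ω => ∑ j ∈ Finset.range (m n), w n j * X j ω) t) atTop
      (𝓝 (charFun (gaussianReal 0 1) t)) := by
  have : ∀ i, IsProbabilityMeasure (P.map (X i)) := fun i => Measure.isProbabilityMeasure_map (hX i)
  have hG0 : (gaussianReal 0 1)[(id : ℝ → ℝ)] = 0 := by simp [integral_id_gaussianReal]
  have hG1 : (gaussianReal 0 1)[(id : ℝ → ℝ) ^ 2] = 1 := by
    have h := variance_id_gaussianReal (μ := 0) (v := 1)
    rw [variance_of_integral_eq_zero aemeasurable_id hG0] at h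
    simpa using h
  -- Both laws have mean `0` and second moment `1`, so their second-order Taylor polynomials
  -- coincide.
  have hdiff : (fun t : ℝ => charFun (P.map (X 0)) t - charFun (gaussianReal 0 1) t)
      =o[𝓝 0] fun t : ℝ => ((t ^ 2 : ℝ)) := by
    have e1 := taylor_charFun_two (hX 0) h0 h1
    have e2 := taylor_charFun_two (P := gaussianReal 0 1) aemeasurable_id hG0 hG1
    rw [Measure.map_id] at e2
    have e3 := e1.sub e2
    rw [← Asymptotics.isLittleO_norm_right] at e3 ⊢
    simpa using e3
  have hprod : ∀ n, charFun (P.map fun ω => ∑ j ∈ Finset.range (m n), w n j * X j ω) t =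
      ∏ j ∈ Finset.range (m n), charFun (P.map (X 0)) (w n j * t) := by
    intro n
    have hi : iIndepFun (fun j ω => w n j * X j ω) P :=
      hindep.comp (fun j x => w n j * x) fun j => by fun_prop
    rw [(hi.restrict _).charFun_map_fun_finsetSum_eq_prod
      (fun j _ => (hX j).const_mul _), Finset.prod_apply]
    refine Finset.prod_congr rfl fun j _ => ?_
    rw [charFun_map_mul_comp (hX j), hident]
  -- Stability of the Gaussian law: since the squared weights sum to `1`, the Gaussian product is
  -- already the limit.
  have hgauss : ∀ᶠ n in atTop, ∏ j ∈ Finset.range (m n), charFun (gaussianReal 0 1) (w n j * t) =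
      charFun (gaussianReal 0 1) t := by
    filter_upwards [hw] with n hn
    simp only [charFun_gaussianReal]
    rw [← Complex.exp_sum]
    congr 1
    have h : ∑ j ∈ Finset.range (m n), ((w n j : ℝ) : ℂ) ^ 2 = 1 := by exact_mod_cast hn
    simp only [Complex.ofReal_zero, mul_zero, zero_mul, zero_sub, NNReal.coe_one,
      Complex.ofReal_one, Complex.ofReal_mul, mul_pow, one_mul]
    rw [Finset.sum_neg_distrib, ← Finset.sum_div, ← Finset.sum_mul, h, one_mul]
  rw [Metric.tendsto_nhds]
  intro ε hε
  have hc : (0 : ℝ) < ε / (2 * (t ^ 2 + 1)) := by positivity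
  obtain ⟨δ, hδ, hδ'⟩ := Metric.eventually_nhds_iff.1 (hdiff.bound hc)
  filter_upwards [hw, hgauss, hw' (δ / (|t| + 1)) (by positivity)] with n hn hgn hwn
  rw [hprod, ← hgn, dist_eq_norm]
  calc _ ≤ ∑ j ∈ Finset.range (m n),
        ‖charFun (P.map (X 0)) (w n j * t) - charFun (gaussianReal 0 1) (w n j * t)‖ :=
        norm_prod_sub_prod_le _ _ _ (fun _ _ => norm_charFun_le_one _)
          fun _ _ => norm_charFun_le_one _
    _ ≤ ∑ j ∈ Finset.range (m n), ε / (2 * (t ^ 2 + 1)) * (t ^ 2 * w n j ^ 2) := by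
        refine Finset.sum_le_sum fun j hj => ?_
        have hlt : |w n j * t| < δ := by
          rw [abs_mul]
          have h2 := hwn j (Finset.mem_range.1 hj)
          rw [lt_div_iff₀ (by positivity)] at h2
          nlinarith [abs_nonneg (w n j), abs_nonneg t]
        have h3 := hδ' (y := w n j * t) (by simpa [Real.dist_eq] using hlt)
        rw [Real.norm_of_nonneg (by positivity)] at h3
        rwa [mul_pow, mul_comm (w n j ^ 2)] at h3
    _ = ε / (2 * (t ^ 2 + 1)) * t ^ 2 := by rw [← Finset.mul_sum, ← Finset.mul_sum, hn, mul_one]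
    _ < ε := by
        rw [div_mul_eq_mul_div, div_lt_iff₀ (by positivity)]
        nlinarith [sq_nonneg t]

/-! ### Uniform convergence of distribution functions. -/

/-- **Pólya's theorem**: if distribution functions converge pointwise to a continuous distribution
function, then they converge uniformly. -/
theorem eventually_forall_abs_sub_lt_of_monotone {F : ℕ → ℝ → ℝ} {G : ℝ → ℝ}
    (hF : ∀ n, Monotone (F n)) (hF0 : ∀ n x, 0 ≤ F n x) (hF1 : ∀ n x, F n x ≤ 1)
    (hG : Continuous G) (hGbot : Tendsto G atBot (𝓝 0)) (hGtop : Tendsto G atTop (𝓝 1))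
    (hlim : ∀ x, Tendsto (fun n => F n x) atTop (𝓝 (G x))) {ε : ℝ} (hε : 0 < ε) :
    ∀ᶠ n in atTop, ∀ x, |F n x - G x| < ε := by
  have hGmono : Monotone G := fun x y hxy =>
    le_of_tendsto_of_tendsto' (hlim x) (hlim y) fun n => hF n hxy
  have hG0 : ∀ x, 0 ≤ G x := fun x => ge_of_tendsto' (hlim x) fun n => hF0 n x
  have hG1 : ∀ x, G x ≤ 1 := fun x => le_of_tendsto' (hlim x) fun n => hF1 n x
  have hpt : ∀ x, ∀ᶠ n in atTop, |F n x - G x| < ε / 4 := fun x =>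
    Metric.tendsto_nhds.1 (hlim x) _ (by positivity)
  -- Monotonicity squeezes `F n` and `G` between their values at two endpoints, where they are close
  -- to each other and `G` varies little.
  have hloc : ∀ x : ℝ, ∃ U ∈ 𝓝 x, ∀ᶠ n in atTop, ∀ a ∈ U, |F n a - G a| < ε := by
    intro x
    obtain ⟨δ, hδ, hδ'⟩ := Metric.continuousAt_iff.1 (hG.continuousAt (x := x)) (ε / 4)
      (by positivity)
    have hy := hδ' (x := x - δ / 2) (by rw [Real.dist_eq, abs_lt]; constructor <;> linarith)
    have hz := hδ' (x := x + δ / 2) (by rw [Real.dist_eq, abs_lt]; constructor <;> linarith)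
    rw [Real.dist_eq, abs_lt] at hy hz
    refine ⟨Set.Icc (x - δ / 2) (x + δ / 2), Icc_mem_nhds (by linarith) (by linarith), ?_⟩
    filter_upwards [hpt (x - δ / 2), hpt (x + δ / 2)] with n h1 h2 a ha
    rw [abs_lt] at h1 h2 ⊢
    have h3 := hF n ha.1
    have h4 := hF n ha.2
    have h5 := hGmono ha.1
    have h6 := hGmono ha.2
    constructor <;> linarith [h1.1, h1.2, h2.1, h2.2]
  obtain ⟨A, hA⟩ := (hGbot.eventually (gt_mem_nhds (show (0 : ℝ) < ε / 4 by positivity))).exists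
  obtain ⟨B, hB⟩ := (hGtop.eventually (lt_mem_nhds (show 1 - ε / 4 < (1 : ℝ) by linarith))).exists
  have hmid : ∀ᶠ n in atTop, ∀ a ∈ Set.Icc A B, |F n a - G a| < ε := by
    refine isCompact_Icc.induction_on (p := fun S => ∀ᶠ n in atTop, ∀ a ∈ S, |F n a - G a| < ε)
      (by simp) (fun S T hST hT => hT.mono fun n hn a ha => hn a (hST ha)) ?_ ?_
    · intro S T hS hT
      filter_upwards [hS, hT] with n h1 h2 a ha
      exact ha.elim (h1 a) (h2 a)
    · intro x _
      obtain ⟨U, hU, h⟩ := hloc x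
      exact ⟨U, mem_nhdsWithin_of_mem_nhds hU, h⟩
  filter_upwards [hmid, hpt A, hpt B] with n h1 h2 h3 a
  rcases lt_or_ge a A with ha | ha
  · rw [abs_lt] at h2 ⊢
    have := hF n ha.le
    have := hGmono ha.le
    constructor <;> linarith [hF0 n a, hG0 a, h2.1, h2.2]
  rcases lt_or_ge B a with hb | hb
  · rw [abs_lt] at h3 ⊢
    have := hF n hb.le
    have := hGmono hb.le
    constructor <;> linarith [hF1 n a, hG1 a, h3.1, h3.2]
  · exact h1 a ⟨ha, hb⟩

/-- Convergence of characteristic functions to that of a law without atoms entails uniform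
convergence of the distribution functions. -/
theorem tendsto_iSup_abs_cdf_sub_of_charFun {μ : ℕ → Measure ℝ} [∀ n, IsProbabilityMeasure (μ n)]
    {ν : Measure ℝ} [IsProbabilityMeasure ν] [NullSingletonClass ν]
    (h : ∀ t, Tendsto (fun n => charFun (μ n) t) atTop (𝓝 (charFun ν t))) :
    Tendsto (fun n => ⨆ a : ℝ, |(μ n).real (Set.Iic a) - ν.real (Set.Iic a)|) atTop (𝓝 0) := by
  have hweak : Tendsto (β := ProbabilityMeasure ℝ) (fun n => ⟨μ n, inferInstance⟩) atTop
      (𝓝 ⟨ν, inferInstance⟩) :=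
    ProbabilityMeasure.tendsto_of_tendsto_charFun h
  have hpt : ∀ x, Tendsto (fun n => (μ n).real (Set.Iic x)) atTop (𝓝 (ν.real (Set.Iic x))) := by
    intro x
    have h1 := ProbabilityMeasure.tendsto_measure_of_null_frontier_of_tendsto' hweak
      (E := Set.Iic x) (by simp)
    exact (ENNReal.tendsto_toReal (measure_ne_top _ _)).comp h1
  have hcont : Continuous fun x => ν.real (Set.Iic x) := by
    -- The jump of the distribution function at `x` is the mass of `{x}`, which vanishes.
    have e : (fun x => ν.real (Set.Iic x)) = cdf ν := funext fun x => (cdf_eq_real ν x).symm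
    rw [e, continuous_iff_continuousAt]
    intro x
    have h2 := (cdf ν).measure_singleton x
    rw [measure_cdf, measure_singleton, eq_comm, ENNReal.ofReal_eq_zero] at h2
    rw [continuousAt_iff_continuous_left_right]
    refine ⟨?_, (cdf ν).right_continuous x⟩
    have h3 := (monotone_cdf ν).tendsto_leftLim x
    have h4 : Function.leftLim (cdf ν) x = cdf ν x :=
      le_antisymm ((monotone_cdf ν).leftLim_le le_rfl) (by linarith)
    rw [h4] at h3
    exact continuousWithinAt_Iio_iff_Iic.1 h3
  have hbot : Tendsto (fun x => ν.real (Set.Iic x)) atBot (𝓝 0) := by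
    exact (tendsto_cdf_atBot ν).congr (cdf_eq_real ν)
  have htop : Tendsto (fun x => ν.real (Set.Iic x)) atTop (𝓝 1) := by
    exact (tendsto_cdf_atTop ν).congr (cdf_eq_real ν)
  rw [Metric.tendsto_nhds]
  intro ε hε
  filter_upwards [eventually_forall_abs_sub_lt_of_monotone
    (F := fun n x => (μ n).real (Set.Iic x))
    (fun n x y hxy => measureReal_mono (Set.Iic_subset_Iic.2 hxy))
    (fun _ _ => measureReal_nonneg) (fun _ _ => measureReal_le_one) hcont hbot htop hpt
    (half_pos hε)] with n hn
  rw [Real.dist_eq, sub_zero, abs_of_nonneg (Real.iSup_nonneg fun _ => abs_nonneg _)]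
  exact (ciSup_le fun a => (hn a).le).trans_lt (half_lt_self hε)

/-! ### The Gaussian integral, the indicators and the weights. -/

theorem measureReal_gaussianReal_Iic (a : ℝ) :
    (gaussianReal 0 1).real (Set.Iic a) =
      ∫ t in Set.Iic a, 1 / √(2 * Real.pi) * Real.exp (-t ^ 2 / 2) := by
  rw [measureReal_def, gaussianReal_apply_eq_integral _ one_ne_zero,
    ENNReal.toReal_ofReal (setIntegral_nonneg measurableSet_Iic
      fun x _ => gaussianPDFReal_nonneg 0 1 x)]
  simp [gaussianPDFReal]

theorem covariance_congr_ae {Ω : Type*} [MeasurableSpace Ω] {P : Measure Ω} {X X' Y Y' : Ω → ℝ}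
    (hX : X =ᵐ[P] X') (hY : Y =ᵐ[P] Y') : covariance X Y P = covariance X' Y' P := by
  rw [covariance, covariance, integral_congr_ae hX, integral_congr_ae hY]
  refine integral_congr_ae ?_
  filter_upwards [hX, hY] with ω h1 h2
  rw [h1, h2]

/-- The two prescribed masses add up to `1`, so no other value has positive probability. -/
theorem ae_eq_zero_or_one_of_measureReal {Ω : Type*} [MeasurableSpace Ω] {P : Measure Ω}
    [IsProbabilityMeasure P] {Z : Ω → ℝ} {p : ℝ} (hZ : Measurable Z)
    (h1 : P.real {ω | Z ω = 1} = p) (h0 : P.real {ω | Z ω = 0} = 1 - p) :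
    ∀ᵐ ω ∂P, Z ω = 0 ∨ Z ω = 1 := by
  have m0 : MeasurableSet {ω | Z ω = 0} := hZ (measurableSet_singleton 0)
  have m1 : MeasurableSet {ω | Z ω = 1} := hZ (measurableSet_singleton 1)
  have hd : Disjoint {ω | Z ω = 0} {ω | Z ω = 1} := by
    rw [Set.disjoint_left]
    intro ω h h'
    simp only [Set.mem_ofPred_eq] at h h'
    rw [h] at h'
    exact zero_ne_one h'
  have hu : P.real ({ω | Z ω = 0} ∪ {ω | Z ω = 1}) = 1 := by
    rw [measureReal_union hd m1, h0, h1, sub_add_cancel]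
  rw [measureReal_def, ENNReal.toReal_eq_one_iff] at hu
  exact mem_ae_iff.2 ((prob_compl_eq_zero_iff (m0.union m1)).2 hu)

theorem pentRes_zero_eq_of_kind {a : Fin 5} {z : ℝ} (h0 : z = 0 → a = 1 ∨ a = 4)
    (h1 : z = 1 → a = 2 ∨ a = 3) (hz : z = 0 ∨ z = 1) :
    pentRes 0 a = 4 / 5 + 2 / 5 * z := by
  rcases hz with hz | hz
  · rcases h0 hz with h | h <;> subst h <;> simp [pentRes, hz, (by decide : (0 : Fin 5) = 4 + 1)]
  · rcases h1 hz with h | h <;> subst h <;> simp [pentRes, hz] <;> norm_num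

/-- The parameter `x` is kept apart from `N` because it must stay fixed in the induction; it is then
set to `N + 1`. -/
theorem sum_range_sq_mul_sub_sq (N : ℕ) (x : ℝ) :
    ∑ j ∈ Finset.range N, (((j : ℝ) + 1) * (x - 1 - j)) ^ 2 =
      x ^ 2 * (N * (N + 1) * (2 * N + 1) / 6) - 2 * x * (N ^ 2 * (N + 1) ^ 2 / 4)
        + N * (N + 1) * (2 * N + 1) * (3 * N ^ 2 + 3 * N - 1) / 30 := by
  induction N with
  | zero => simp
  | succ N ih => rw [Finset.sum_range_succ, ih]; push_cast; ring

theorem sum_range_weight_sq (m : ℕ) :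
    ∑ j ∈ Finset.range (m - 1), (((j : ℝ) + 1) * (m - 1 - j)) ^ 2 =
      ((m : ℝ) ^ 5 - m) / 30 := by
  rcases m with _ | N
  · simp
  · rw [sum_range_sq_mul_sub_sq, add_tsub_cancel_right]
    push_cast
    ring

/-- The weights `j (m - j)`, normalized in the quadratic mean, are uniformly negligible. -/
theorem eventually_forall_normalized_weight_lt {ε : ℝ} (hε : 0 < ε) :
    ∀ᶠ m : ℕ in atTop, ∀ j < m - 1,
      |((j : ℝ) + 1) * (m - 1 - j) / √(((m : ℝ) ^ 5 - m) / 30)| < ε := by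
  -- The weight is at most `m²` and the variance exceeds `m⁵ / 60`, so the squared ratio is below
  -- `60 / m < ε²`.
  filter_upwards [eventually_ge_atTop 2,
    tendsto_natCast_atTop_atTop.eventually_gt_atTop (60 / ε ^ 2)] with m hm hmε j hj
  have hm' : (2 : ℝ) ≤ m := by exact_mod_cast hm
  have hj' : (j : ℝ) + 1 + 1 ≤ m := by exact_mod_cast (show j + 1 + 1 ≤ m by omega)
  have hj0 : (0 : ℝ) ≤ j := Nat.cast_nonneg j
  have h4 : (16 : ℝ) ≤ (m : ℝ) ^ 4 := by
    calc (16 : ℝ) = 2 ^ 4 := by norm_num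
      _ ≤ (m : ℝ) ^ 4 := by gcongr
  have hv : (m : ℝ) ^ 5 / 60 < ((m : ℝ) ^ 5 - m) / 30 := by nlinarith
  have hvpos : 0 < ((m : ℝ) ^ 5 - m) / 30 := lt_trans (by positivity) hv
  have ha0 : (0 : ℝ) ≤ ((j : ℝ) + 1) * (m - 1 - j) := mul_nonneg (by linarith) (by linarith)
  have ha : ((j : ℝ) + 1) * (m - 1 - j) ≤ (m : ℝ) ^ 2 := by nlinarith
  rw [abs_of_nonneg (by positivity), div_lt_iff₀ (Real.sqrt_pos.2 hvpos)]
  refine lt_of_le_of_lt ha (lt_of_pow_lt_pow_left₀ 2 (by positivity) ?_)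
  rw [mul_pow, Real.sq_sqrt hvpos.le]
  rw [div_lt_iff₀ (by positivity)] at hmε
  calc ((m : ℝ) ^ 2) ^ 2 = 60 * (m : ℝ) ^ 4 / 60 := by ring
    _ ≤ (m * ε ^ 2) * (m : ℝ) ^ 4 / 60 := by gcongr
    _ = ε ^ 2 * ((m : ℝ) ^ 5 / 60) := by ring
    _ < _ := by gcongr

/-! ### The random chain. -/

theorem theorem3p3 {Ω : Type*} [MeasurableSpace Ω] (P : Measure Ω) [IsProbabilityMeasure P]
    -- the probabilities of the two kinds of steps
    (p₁ p₂ : ℝ) (hp₂ : p₂ = 1 - p₁) (hp₁_pos : 0 < p₁) (hp₁_lt : p₁ < 1)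
    -- the indicators of the two kinds of the step from `n` to `n + 1` pentagons, `n ≥ 2`
    (Z₁ Z₂ : ℕ → Ω → ℝ)
    (hZ₁_meas : ∀ n, 2 ≤ n → Measurable (Z₁ n)) (hZ₂_meas : ∀ n, 2 ≤ n → Measurable (Z₂ n))
    (hZ₁ : ∀ n, 2 ≤ n → P.real {ω | Z₁ n ω = 1} = p₁ ∧ P.real {ω | Z₁ n ω = 0} = 1 - p₁)
    (hZ₂ : ∀ n, 2 ≤ n → P.real {ω | Z₂ n ω = 1} = p₂ ∧ P.real {ω | Z₂ n ω = 0} = 1 - p₂)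
    (hZ_sum : ∀ n, 2 ≤ n → ∀ᵐ ω ∂P, Z₁ n ω + Z₂ n ω = 1)
    (hZ_indep : iIndepFun (fun (n : {n : ℕ // 2 ≤ n}) (ω : Ω) => (Z₁ n ω, Z₂ n ω)) P)
    -- the attaching vertex on the `n`-th pentagon: `x₂` or `x₅` in a step of the first kind,
    -- `x₃` or `x₄` in a step of the second kind
    (s : ℕ → Ω → Fin 5)
    (hs₁ : ∀ n, 2 ≤ n → ∀ ω, Z₁ n ω = 1 → s n ω = 1 ∨ s n ω = 4)
    (hs₂ : ∀ n, 2 ≤ n → ∀ ω, Z₂ n ω = 1 → s n ω = 2 ∨ s n ω = 3)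
    -- the index of the random chain
    (Kf : ℕ → Ω → ℝ)
    (hKf : ∀ n ω, Kf n ω = mulDegreeKirchhoffIndex (pentagonChain n (fun k => s k ω)))
    (U V : ℕ → Ω → ℝ)
    (hU : ∀ n ω, U n ω = 1296 / 5 * Z₁ n ω + 1584 / 5 * Z₂ n ω)
    (hV : ∀ n ω, V n ω = 876 / 5 * Z₁ n ω + 1164 / 5 * Z₂ n ω)
    (σsq τsq r : ℝ)
    (hσ : σsq = (1296 / 5) ^ 2 * p₁ + (1584 / 5) ^ 2 * (1 - p₁)
      - (1296 / 5 * p₁ + 1584 / 5 * (1 - p₁)) ^ 2)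
    (hτ : τsq = (876 / 5) ^ 2 * p₁ + (1164 / 5) ^ 2 * (1 - p₁)
      - (876 / 5 * p₁ + 1164 / 5 * (1 - p₁)) ^ 2)
    (hr : r = 1296 / 5 * (876 / 5) * p₁ + 1584 / 5 * (1164 / 5) * (1 - p₁)
      - (1296 / 5 * p₁ + 1584 / 5 * (1 - p₁)) * (876 / 5 * p₁ + 1164 / 5 * (1 - p₁))) :
    (∀ n, 2 ≤ n → variance (U n) P = σsq ∧ variance (V n) P = τsq ∧
      covariance (U n) (V n) P = r) ∧
    (∀ n, 1 ≤ n → MemLp (Kf n) 2 P ∧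
      variance (Kf n) P =
        1 / 30 * (σsq * (n : ℝ) ^ 5 - 5 * r * (n : ℝ) ^ 4 + 10 * τsq * (n : ℝ) ^ 3
          + (65 * r - 30 * σsq - 45 * τsq) * (n : ℝ) ^ 2
          + (59 * σsq + 65 * τsq - 120 * r) * (n : ℝ)
          + (60 * r - 30 * σsq - 30 * τsq))) ∧
    Tendsto (fun n : ℕ => ⨆ a : ℝ,
        |P.real {ω | (Kf n ω - ∫ ω', Kf n ω' ∂P) / √(variance (Kf n) P) ≤ a}
          - ∫ t in Set.Iic a, 1 / √(2 * Real.pi) * Real.exp (-t ^ 2 / 2)|)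
      atTop (𝓝 0) := by
  have hp₂_pos : 0 < p₂ := by linarith
  have hv : 0 < p₁ * p₂ := mul_pos hp₁_pos hp₂_pos
  have hZ01 : ∀ k, 2 ≤ k → ∀ᵐ ω ∂P, Z₂ k ω = 0 ∨ Z₂ k ω = 1 := fun k hk =>
    ae_eq_zero_or_one_of_measureReal (hZ₂_meas k hk) (hZ₂ k hk).1 (hZ₂ k hk).2
  have hZL2 : ∀ k, 2 ≤ k → MemLp (Z₂ k) 2 P := fun k hk => by
    refine MemLp.of_bound (hZ₂_meas k hk).aestronglyMeasurable 1 ?_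
    filter_upwards [hZ01 k hk] with ω h
    rcases h with h | h <;> simp [h]
  have hZmean : ∀ k, 2 ≤ k → ∫ ω, Z₂ k ω ∂P = p₂ := fun k hk => by
    rw [integral_of_ae_eq_zero_or_one (hZ₂_meas k hk).aemeasurable (hZ01 k hk), (hZ₂ k hk).1]
  have hZvar : ∀ k, 2 ≤ k → variance (Z₂ k) P = p₁ * p₂ := fun k hk => by
    rw [variance_of_ae_eq_zero_or_one (hZ₂_meas k hk).aemeasurable (hZ01 k hk), (hZ₂ k hk).1,
      (hZ₂ k hk).2, hp₂, sub_sub_cancel]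
  -- Here `288/5` is both `144 * (2/5)` and the common difference `(1584 - 1296)/5 = (1164 -
  -- 876)/5`.
  set κ : ℝ := 288 / 5 * √(p₁ * p₂) with hκ_def
  have hκ : 0 < κ := mul_pos (by norm_num) (Real.sqrt_pos.2 hv)
  have hκ2 : κ ^ 2 = (288 / 5) ^ 2 * (p₁ * p₂) := by rw [hκ_def, mul_pow, Real.sq_sqrt hv.le]
  have hσκ : σsq = κ ^ 2 := by rw [hσ, hκ2, hp₂]; ring
  have hτκ : τsq = κ ^ 2 := by rw [hτ, hκ2, hp₂]; ring
  have hrκ : r = κ ^ 2 := by rw [hr, hκ2, hp₂]; ring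
  -- the standardized indicators
  set X : ℕ → Ω → ℝ := fun j ω => (Z₂ (j + 2) ω - p₂) / √(p₁ * p₂) with hX_def
  have hXmeas : ∀ j, Measurable (X j) := fun j =>
    ((hZ₂_meas (j + 2) (by omega)).sub_const _).div_const _
  have hXindep : iIndepFun X P :=
    (hZ_indep.precomp (g := fun j : ℕ => (⟨j + 2, by omega⟩ : {n : ℕ // 2 ≤ n}))
      (fun i j h => by simpa using h)).comp (fun _ z => (z.2 - p₂) / √(p₁ * p₂))
      (fun _ => by fun_prop)
  have hXident : ∀ j, P.map (X j) = P.map (X 0) := by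
    -- A law carried by `{0, 1}` is determined by its two masses.
    have h1 : ∀ j, P.map (Z₂ (j + 2)) = P.map (Z₂ (0 + 2)) := by
      intro j
      rw [(Measure.ae_eq_or_eq_iff_map_eq_dirac_add_dirac (hZ₂_meas (j + 2) (by omega)).aemeasurable
          zero_ne_one).1 (hZ01 (j + 2) (by omega)),
        (Measure.ae_eq_or_eq_iff_map_eq_dirac_add_dirac (hZ₂_meas (0 + 2) (by omega)).aemeasurable
          zero_ne_one).1 (hZ01 (0 + 2) (by omega))]
      congr 2
      · exact (measureReal_eq_measureReal_iff).1
          ((hZ₂ (j + 2) (by omega)).2.trans (hZ₂ (0 + 2) (by omega)).2.symm)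
      · exact (measureReal_eq_measureReal_iff).1
          ((hZ₂ (j + 2) (by omega)).1.trans (hZ₂ (0 + 2) (by omega)).1.symm)
    have h2 : ∀ j, P.map (X j) = (P.map (Z₂ (j + 2))).map fun z => (z - p₂) / √(p₁ * p₂) :=
      fun j => (Measure.map_map (g := fun z => (z - p₂) / √(p₁ * p₂)) (by fun_prop)
        (hZ₂_meas (j + 2) (by omega))).symm
    intro j
    rw [h2, h2, h1]
  have hXL2 : ∀ j, MemLp (X j) 2 P := fun j => by
    have h := ((hZL2 (j + 2) (by omega)).sub (memLp_const p₂)).const_mul (√(p₁ * p₂))⁻¹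
    refine h.ae_eq (Eventually.of_forall fun ω => ?_)
    simp only [Pi.sub_apply, hX_def]
    ring
  have hXmean : ∀ j, ∫ ω, X j ω ∂P = 0 := fun j => by
    simp only [hX_def]
    rw [integral_div, integral_sub ((hZL2 (j + 2) (by omega)).integrable one_le_two)
      (integrable_const _), hZmean _ (by omega)]
    simp
  have hXvar : ∀ j, variance (X j) P = 1 := fun j => by
    have e : X j = fun ω => (√(p₁ * p₂))⁻¹ * (Z₂ (j + 2) ω - p₂) := by
      funext ω; simp only [hX_def]; ring
    rw [e, variance_const_mul,
      variance_sub_const (hZ₂_meas (j + 2) (by omega)).aestronglyMeasurable,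
      hZvar _ (by omega), inv_pow, Real.sq_sqrt hv.le, inv_mul_cancel₀ hv.ne']
  -- the index as an affine function of the standardized indicators
  set S : ℕ → Ω → ℝ := fun m ω => ∑ j ∈ Finset.range (m - 1), ((j : ℝ) + 1) * (m - 1 - j) * X j ω
    with hS_def
  have hSterm : ∀ (c : ℝ) j, MemLp (fun ω => c * X j ω) 2 P := fun c j => (hXL2 j).const_mul c
  have hSL2 : ∀ m, MemLp (S m) 2 P := fun m => memLp_finsetSum _ fun j _ => hSterm _ j
  have hSmean : ∀ m, ∫ ω, S m ω ∂P = 0 := fun m => by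
    simp only [hS_def]
    rw [integral_finsetSum _ fun j _ => (hSterm _ j).integrable one_le_two]
    refine Finset.sum_eq_zero fun j _ => ?_
    rw [integral_const_mul, hXmean, mul_zero]
  have hSvar : ∀ m : ℕ, variance (S m) P = ((m : ℝ) ^ 5 - m) / 30 := fun m => by
    have e : S m = ∑ j ∈ Finset.range (m - 1), fun ω => ((j : ℝ) + 1) * (m - 1 - j) * X j ω := by
      funext ω; simp [hS_def]
    rw [e, IndepFun.variance_sum (fun j _ => hSterm _ j), ← sum_range_weight_sq]
    · refine Finset.sum_congr rfl fun j _ => ?_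
      rw [variance_const_mul, hXvar, mul_one]
    · intro i _ j _ hij
      exact (hXindep.indepFun hij).comp (φ := fun x => ((i : ℝ) + 1) * (m - 1 - i) * x)
        (ψ := fun x => ((j : ℝ) + 1) * (m - 1 - j) * x) (by fun_prop) (by fun_prop)
  have hKfS : ∀ m, ∃ c : ℝ, Kf (m + 1) =ᵐ[P] fun ω => c + κ * S m ω := by
    intro m
    obtain ⟨c, hc⟩ := exists_chainIndex_eq m
    -- The constant is the index with every `r(x₁, u_k)`, `k ≥ 2`, replaced by its mean.
    refine ⟨c + 144 * ∑ j ∈ Finset.range (m - 1), ((j : ℝ) + 1) * (m - 1 - j) *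
      (4 / 5 + 2 / 5 * p₂), ?_⟩
    have hall : ∀ᵐ ω ∂P, ∀ k, 2 ≤ k → pentRes 0 (s k ω) = 4 / 5 + 2 / 5 * Z₂ k ω := by
      rw [ae_all_iff]
      intro k
      by_cases hk : 2 ≤ k
      · filter_upwards [hZ01 k hk, hZ_sum k hk] with ω h01 hsum _
        exact pentRes_zero_eq_of_kind (fun h => hs₁ k hk ω (by rw [h] at hsum; linarith))
          (hs₂ k hk ω) h01
      · exact Eventually.of_forall fun ω h => absurd h hk
    filter_upwards [hall] with ω hω
    rw [hKf]
    change chainIndex m (fun k => s k ω) = _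
    rw [hc, add_assoc]
    congr 1
    simp only [hS_def]
    rw [Finset.mul_sum, Finset.mul_sum, Finset.mul_sum, ← Finset.sum_add_distrib]
    refine Finset.sum_congr rfl fun j _ => ?_
    rw [hω (j + 2) (by omega)]
    have hX' : √(p₁ * p₂) * X j ω = Z₂ (j + 2) ω - p₂ :=
      mul_div_cancel₀ _ (Real.sqrt_pos.2 hv).ne'
    have hκX : κ * X j ω = 288 / 5 * (Z₂ (j + 2) ω - p₂) := by rw [hκ_def, mul_assoc, hX']
    rw [mul_left_comm κ, hκX]
    ring
  have hKfvar : ∀ m, variance (Kf (m + 1)) P = κ ^ 2 * (((m : ℝ) ^ 5 - m) / 30) := fun m => by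
    obtain ⟨c, hc⟩ := hKfS m
    rw [variance_congr hc, variance_const_add ((hSL2 m).const_mul κ).aestronglyMeasurable,
      variance_const_mul, hSvar]
  refine ⟨fun k hk => ?_, fun n hn => ?_, ?_⟩
  · have hU' : U k =ᵐ[P] fun ω => 1296 / 5 + 288 / 5 * Z₂ k ω := by
      filter_upwards [hZ_sum k hk] with ω h
      rw [hU, ← eq_sub_iff_add_eq.2 h |>.symm]
      ring
    have hV' : V k =ᵐ[P] fun ω => 876 / 5 + 288 / 5 * Z₂ k ω := by
      filter_upwards [hZ_sum k hk] with ω h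
      rw [hV, ← eq_sub_iff_add_eq.2 h |>.symm]
      ring
    have hL := (hZL2 k hk).const_mul (288 / 5)
    refine ⟨?_, ?_, ?_⟩
    · rw [variance_congr hU', variance_const_add hL.aestronglyMeasurable, variance_const_mul,
        hZvar k hk, hσκ, hκ2]
    · rw [variance_congr hV', variance_const_add hL.aestronglyMeasurable, variance_const_mul,
        hZvar k hk, hτκ, hκ2]
    · rw [covariance_congr_ae hU' hV', covariance_const_add_left (hL.integrable one_le_two),
        covariance_const_add_right (hL.integrable one_le_two), covariance_const_mul_left,
        covariance_const_mul_right, covariance_self (hZ₂_meas k hk).aemeasurable, hZvar k hk,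
        hrκ, hκ2]
      ring
  · obtain ⟨m, rfl⟩ : ∃ m, n = m + 1 := ⟨n - 1, by omega⟩
    obtain ⟨c, hc⟩ := hKfS m
    refine ⟨(((memLp_const c).add ((hSL2 m).const_mul κ)).ae_eq hc.symm), ?_⟩
    rw [hKfvar, hσκ, hτκ, hrκ]
    push_cast
    ring
  · rw [← tendsto_add_atTop_iff_nat 1]
    set T : ℕ → Ω → ℝ := fun m ω => ∑ j ∈ Finset.range (m - 1),
      ((j : ℝ) + 1) * (m - 1 - j) / √(((m : ℝ) ^ 5 - m) / 30) * X j ω with hT_def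
    have hTmeas : ∀ m, Measurable (T m) := fun m =>
      Finset.measurable_fun_sum _ fun j _ => (hXmeas j).const_mul _
    have hTprob : ∀ m, IsProbabilityMeasure (P.map (T m)) := fun m =>
      Measure.isProbabilityMeasure_map (hTmeas m).aemeasurable
    have hchar := tendsto_charFun_weighted_sum (P := P) (fun j => (hXmeas j).aemeasurable) hXindep
      hXident (hXmean 0)
      (by
        rw [← hXvar 0, variance_of_integral_eq_zero (hXmeas 0).aemeasurable (hXmean 0)]
        rfl)
      (m := fun m => m - 1)
      (w := fun m j => ((j : ℝ) + 1) * (m - 1 - j) / √(((m : ℝ) ^ 5 - m) / 30))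
      (by
        filter_upwards [eventually_ge_atTop 2] with m hm
        have hm' : (2 : ℝ) ≤ m := by exact_mod_cast hm
        have h4 : (16 : ℝ) ≤ (m : ℝ) ^ 4 := by
          calc (16 : ℝ) = 2 ^ 4 := by norm_num
            _ ≤ (m : ℝ) ^ 4 := by gcongr
        have hvpos : 0 < ((m : ℝ) ^ 5 - m) / 30 := by nlinarith
        simp only [div_pow]
        rw [← Finset.sum_div, sum_range_weight_sq, Real.sq_sqrt hvpos.le, div_self hvpos.ne'])
      (fun ε hε => eventually_forall_normalized_weight_lt hε)
    have := nullSingletonClass_gaussianReal (μ := 0) (v := 1) one_ne_zero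
    have hlim := tendsto_iSup_abs_cdf_sub_of_charFun (μ := fun m => P.map (T m))
      (ν := gaussianReal 0 1) hchar
    refine hlim.congr fun m => iSup_congr fun a => ?_
    rw [measureReal_gaussianReal_Iic, map_measureReal_apply (hTmeas m) measurableSet_Iic]
    congr 2
    refine measureReal_congr ?_
    obtain ⟨c, hc⟩ := hKfS m
    have hmean : ∫ ω, Kf (m + 1) ω ∂P = c := by
      rw [integral_congr_ae hc, integral_add (integrable_const c)
        (((hSL2 m).const_mul κ).integrable one_le_two), integral_const_mul, hSmean]
      simp
    filter_upwards [hc] with ω hω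
    -- Only `κ` has to be nonzero: when the variance vanishes (`m ≤ 1`), both sides are `0` by the
    -- convention for division by zero.
    have hTS : (Kf (m + 1) ω - ∫ ω', Kf (m + 1) ω' ∂P) / √(variance (Kf (m + 1)) P) = T m ω := by
      rw [hmean, hω, hKfvar, add_sub_cancel_left, Real.sqrt_mul (sq_nonneg κ),
        Real.sqrt_sq hκ.le, mul_div_mul_left _ _ hκ.ne', hS_def, hT_def]
      simp only [Finset.sum_div]
      exact Finset.sum_congr rfl fun j _ => by ring
    change (T m ω ≤ a) = ((Kf (m + 1) ω - ∫ ω', Kf (m + 1) ω' ∂P) / √(variance (Kf (m + 1)) P) ≤ a)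
    rw [hTS]
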